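/- There is a universal constant $c>0$ such that the following holds. Let $G$ be a finite simple graph with maximum degree $\Delta\ge 2$ which is claw-free, i.e. has no induced subgraph isomorphic to $K_{1,3}$. Then $$\operatorname{lcc}(G)\;\le\; c\,\frac{\Delta}{\log\Delta},$$ where $\log$ is the natural logarithm and the local clique cover number $\operatorname{lcc}(G)$ is the smallest integer $k\ge 0$ for which there is a family $\mathcal C$ of cliques of $G$ such that every edge of $G$ is contained in at least one clique of $\mathcal C$ and every vertex of $G$ belongs to at most $k$ cliques of $\mathcal C$. -/

import Mathlib

namespace SimpleGraph

universe u

variable {V : Type u}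

/-- A graph is claw-free if the complete bipartite graph `K_{1,3}` is not an induced subgraph. -/
def IsClawFree (G : SimpleGraph V) : Prop :=
  ¬ (completeBipartiteGraph (Fin 1) (Fin 3)).IsIndContained G

/-- A clique covering: a family of cliques (as vertex sets) such that each edge lies in at least
one of them. -/
structure IsCliqueCovering (G : SimpleGraph V) (C : Finset (Finset V)) : Prop where
  isClique : ∀ s ∈ C, G.IsClique (s : Set V)
  exists_mem : ∀ x y : V, G.Adj x y → ∃ s ∈ C, x ∈ s ∧ y ∈ s

/-- The valency of a vertex `x` in a family `C`: the number of members of `C` containing `x`. -/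
def vertexValency [DecidableEq V] (C : Finset (Finset V)) (x : V) : ℕ :=
  (C.filter (fun s => x ∈ s)).card

/-- The valency of a family `C`: the maximum valency of a vertex (`0` if there is no vertex). -/
def coveringValency [Fintype V] [DecidableEq V] (C : Finset (Finset V)) : ℕ :=
  Finset.univ.sup (vertexValency C)

/-- The local clique cover number: the minimum valency of a clique covering. -/
noncomputable def lcc [Fintype V] [DecidableEq V] (G : SimpleGraph V) : ℕ :=
  sInf {k : ℕ | ∃ C : Finset (Finset V), G.IsCliqueCovering C ∧ coveringValency C = k}

/-- The minimum in the definition of `lcc` is taken over a nonempty set. -/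
theorem exists_isCliqueCovering [Fintype V] (G : SimpleGraph V) :
    ∃ C : Finset (Finset V), G.IsCliqueCovering C := by
  classical
  refine ⟨Finset.univ.filter (fun s : Finset V => G.IsClique (s : Set V)), ?_, ?_⟩
  · intro s hs
    exact (Finset.mem_filter.mp hs).2
  · intro x y h
    refine ⟨{x, y}, ?_, by simp, by simp⟩
    simp [h]

/-- The minimum in the definition of `lcc` is attained. -/
theorem exists_coveringValency_eq_lcc [Fintype V] [DecidableEq V] (G : SimpleGraph V) :
    ∃ C : Finset (Finset V), G.IsCliqueCovering C ∧ coveringValency C = G.lcc := by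
  have h : {k : ℕ | ∃ C : Finset (Finset V),
      G.IsCliqueCovering C ∧ coveringValency C = k}.Nonempty := by
    obtain ⟨C, hC⟩ := G.exists_isCliqueCovering
    exact ⟨_, C, hC, rfl⟩
  exact Nat.sInf_mem h

end SimpleGraph

namespace SimpleGraph

variable {V : Type*}

/-! Let `k` be of order log Δ and let `P` be a maximal family of disjoint `k`-cliques.
Neighbourhoods contain no independent triple, so any `k * k` vertices of one contain a `k`-clique;
hence each vertex has at most `k * k` neighbours outside `P`.

Edges from the members `A` of a disjoint family to prescribed sets `S A` are covered by grouping
vertices of `S A` by their trace on `A` and by a clique partition of one neighbourhood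
(`exists_cliques_covering_edges_to_parts`). A vertex pays one clique per `A` with it in `S A`, plus
a small term `2 ^ k * N` for its own part. So it suffices to attach each vertex to O(Δ/k) parts.

A vertex adjacent to half of a part is strong there, which happens for at most 2Δ/k parts. For an
edge weak in both directions, a second maximal disjoint family `Q` is used: `k`-cliques in which
each `u` has at most `k / 2` other members strong to the `P`-part of `u`. If `u` is in `B ∈ Q`, then
`lt_card_isStrong` forces the other end to be strong to `B`. Otherwise, weak neighbours of a vertex
`x` missed by `Q` form a clique (`adj_of_not_isStrong`); were they in too many parts,
`exists_subset_card_eq_indegree_le` would extract a new member of `Q`. -/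

theorem IsClawFree.adj_of_not_adj {G : SimpleGraph V} (hG : G.IsClawFree) {v a b c : V}
    (ha : G.Adj v a) (hb : G.Adj v b) (hc : G.Adj v c) (hab : a ≠ b) (hac : a ≠ c)
    (nab : ¬ G.Adj a b) (nac : ¬ G.Adj a c) (hbc : b ≠ c) : G.Adj b c := by
  by_contra nbc
  refine hG ⟨⟨⟨Sum.elim (fun _ => v) ![a, b, c], ?_⟩, ?_⟩⟩
  · rintro (i | i) (j | j) h
    · exact congrArg Sum.inl (Subsingleton.elim i j)
    · exfalso
      fin_cases j <;> simp at h
      · exact ha.ne h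
      · exact hb.ne h
      · exact hc.ne h
    · exfalso
      fin_cases i <;> simp at h
      · exact ha.ne h.symm
      · exact hb.ne h.symm
      · exact hc.ne h.symm
    · fin_cases i <;> fin_cases j <;> simp_all
  · intro x y
    change G.Adj (Sum.elim (fun _ => v) ![a, b, c] x) (Sum.elim (fun _ => v) ![a, b, c] y) ↔ _
    have nba : ¬ G.Adj b a := fun h => nab h.symm
    have nca : ¬ G.Adj c a := fun h => nac h.symm
    have ncb : ¬ G.Adj c b := fun h => nbc h.symm
    rcases x with i | i <;> rcases y with j | j
    · simp
    · fin_cases j <;> simp [ha, hb, hc]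
    · fin_cases i <;> simp [ha.symm, hb.symm, hc.symm]
    · fin_cases i <;> fin_cases j <;> simp [nab, nac, nbc, nba, nca, ncb]

theorem lcc_le [Fintype V] [DecidableEq V] {G : SimpleGraph V} {C : Finset (Finset V)}
    (hC : G.IsCliqueCovering C) {m : ℕ} (h : ∀ v, vertexValency C v ≤ m) : G.lcc ≤ m :=
  (show G.lcc ≤ coveringValency C from Nat.sInf_le ⟨C, hC, rfl⟩).trans
    (Finset.sup_le fun v _ => h v)

theorem vertexValency_union_le [DecidableEq V] (C D : Finset (Finset V)) (v : V) :
    vertexValency (C ∪ D) v ≤ vertexValency C v + vertexValency D v := by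
  unfold vertexValency
  rw [Finset.filter_union]
  exact Finset.card_union_le _ _

/-! ### Disjoint families and cliques inside neighbourhoods. -/

/-- Among the finite sets with a given property there is a maximal pairwise disjoint family. -/
theorem exists_maximal_disjoint_family [Fintype V] (p : Finset V → Prop) :
    ∃ P : Finset (Finset V), (∀ A ∈ P, p A) ∧ (P : Set (Finset V)).PairwiseDisjoint id ∧
      ∀ A : Finset V, p A → A.Nonempty → ∃ B ∈ P, ¬ Disjoint A B := by
  classical
  let F : Finset (Finset (Finset V)) := Finset.univ.filter fun P =>
    (∀ A ∈ P, p A) ∧ (P : Set (Finset V)).PairwiseDisjoint id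
  have hF : F.Nonempty := ⟨∅, by simp [F]⟩
  obtain ⟨P, hP, hmax⟩ := F.exists_max_image Finset.card hF
  simp only [F, Finset.mem_filter, Finset.mem_univ, true_and] at hP hmax
  refine ⟨P, hP.1, hP.2, fun A hA hne => ?_⟩
  by_contra! hd
  have hAP : A ∉ P := fun h => hne.ne_empty (by simpa using hd A h)
  have := hmax (insert A P) ⟨?_, ?_⟩
  · rw [Finset.card_insert_of_notMem hAP] at this
    omega
  · intro B hB
    rcases Finset.mem_insert.1 hB with rfl | hB
    exacts [hA, hP.1 B hB]
  · rw [Finset.coe_insert]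
    exact hP.2.insert fun B hB _ => hd B hB

/-- Ramsey argument: the non-neighbours of a vertex form a clique, so either there are `t` of them,
or at most `t` vertices are lost on passing to its neighbours. -/
theorem exists_isClique_card_of_no_three_independent [DecidableEq V] (G : SimpleGraph V)
    [DecidableRel G.Adj] (t r : ℕ) (T : Finset V)
    (hT : ∀ a ∈ T, ∀ b ∈ T, ∀ c ∈ T, a ≠ b → a ≠ c → ¬ G.Adj a b → ¬ G.Adj a c → b ≠ c →
      G.Adj b c)
    (hr : r ≤ t) (hcard : r * t ≤ T.card) :
    ∃ A ⊆ T, G.IsClique (A : Set V) ∧ A.card = r := by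
  induction r generalizing T with
  | zero => exact ⟨∅, by simp, by simp, rfl⟩
  | succ r ih =>
    have hpos : 0 < T.card := lt_of_lt_of_le (Nat.mul_pos r.succ_pos (by omega)) hcard
    obtain ⟨v, hv⟩ := Finset.card_pos.1 hpos
    by_cases hbig : t ≤ ((T.erase v).filter fun x => ¬ G.Adj v x).card
    · obtain ⟨A, hA, hAc⟩ := Finset.exists_subset_card_eq (hr.trans hbig)
      refine ⟨A, fun x hx => ?_, ?_, hAc⟩
      · exact Finset.mem_of_mem_erase (Finset.mem_filter.1 (hA hx)).1
      · intro x hx y hy hxy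
        have hx' := hA (Finset.mem_coe.1 hx)
        have hy' := hA (Finset.mem_coe.1 hy)
        simp only [Finset.mem_filter, Finset.mem_erase] at hx' hy'
        exact hT v hv x hx'.1.2 y hy'.1.2 hx'.1.1.symm hy'.1.1.symm hx'.2 hy'.2 hxy
    · have hsplit := Finset.card_filter_add_card_filter_not (s := T.erase v) (fun x => G.Adj v x)
      rw [Finset.card_erase_of_mem hv] at hsplit
      have hsub : (T.erase v).filter (fun x => G.Adj v x) ⊆ T :=
        (Finset.filter_subset _ _).trans (Finset.erase_subset _ _)
      obtain ⟨A, hA, hAcl, hAc⟩ := ih ((T.erase v).filter fun x => G.Adj v x)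
        (fun a ha b hb c hc => hT a (hsub ha) b (hsub hb) c (hsub hc)) (by omega) (by
          rw [Nat.succ_mul] at hcard
          omega)
      have hadj : ∀ x ∈ A, G.Adj v x := fun x hx => (Finset.mem_filter.1 (hA hx)).2
      refine ⟨insert v A, ?_, ?_, ?_⟩
      · exact Finset.insert_subset hv (hA.trans hsub)
      · rw [Finset.coe_insert]
        exact hAcl.insert fun x hx _ => hadj x hx
      · rw [Finset.card_insert_of_notMem fun h => G.irrefl (hadj v h), hAc]

theorem card_mul_le_of_pairwiseDisjoint [DecidableEq V] {P : Finset (Finset V)} {T : Finset V} {t m : ℕ}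
    (hP : (P : Set (Finset V)).PairwiseDisjoint id)
    (h : ∀ A ∈ P, t ≤ m * (T ∩ A).card) : P.card * t ≤ m * T.card := by
  calc P.card * t ≤ ∑ A ∈ P, m * (T ∩ A).card := by
        rw [← smul_eq_mul]; exact Finset.card_nsmul_le_sum _ _ _ h
    _ = m * (P.biUnion fun A => T ∩ A).card := by
        rw [← Finset.mul_sum, Finset.card_biUnion]
        intro A hA B hB hAB
        exact (hP hA hB hAB).mono Finset.inter_subset_right Finset.inter_subset_right
    _ ≤ m * T.card := by
        refine Nat.mul_le_mul_left _ (Finset.card_le_card ?_)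
        exact Finset.biUnion_subset.2 fun A _ => Finset.inter_subset_left

section

variable [Fintype V] [DecidableEq V] {G : SimpleGraph V} [DecidableRel G.Adj]

theorem IsClawFree.exists_isClique_card (hG : G.IsClawFree) {v : V} {T : Finset V}
    (hT : T ⊆ G.neighborFinset v) {t : ℕ} (ht : t * t ≤ T.card) :
    ∃ A ⊆ T, G.IsClique (A : Set V) ∧ A.card = t := by
  refine exists_isClique_card_of_no_three_independent G t t T ?_ le_rfl ht
  intro a ha b hb c hc hab hac nab nac hbc
  have h : ∀ x ∈ T, G.Adj v x := fun x hx => by simpa using hT hx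
  exact hG.adj_of_not_adj (h a ha) (h b hb) (h c hc) hab hac nab nac hbc

/-- In a claw-free graph, each neighbourhood can be partitioned into few cliques. -/
theorem IsClawFree.exists_clique_partition (hG : G.IsClawFree) (v : V) {t : ℕ} (ht : 0 < t) :
    ∃ f : V → Finset V, (∀ x, x ∈ f x ∧ G.IsClique (f x : Set V)) ∧
      ((G.neighborFinset v).image f).card * t ≤ G.degree v + t ^ 3 := by
  obtain ⟨P, hp, hd, hmax⟩ := exists_maximal_disjoint_family fun A : Finset V =>
    A ⊆ G.neighborFinset v ∧ G.IsClique (A : Set V) ∧ A.card = t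
  -- Vertices missed by `P` become singletons; by maximality at most `t * t` of them are neighbours
  -- of `v`.
  have hf : ∀ x, ∃ A : Finset V, x ∈ A ∧ G.IsClique (A : Set V) ∧
      ((∃ B ∈ P, x ∈ B) → A ∈ P) ∧ ((¬ ∃ B ∈ P, x ∈ B) → A = {x}) := by
    intro x
    by_cases h : ∃ B ∈ P, x ∈ B
    · obtain ⟨B, hB, hx⟩ := h
      exact ⟨B, hx, (hp B hB).2.1, fun _ => hB, fun h => absurd ⟨B, hB, hx⟩ h⟩
    · exact ⟨{x}, by simp, by simp, fun h' => absurd h' h, fun _ => rfl⟩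
  choose f hf1 hf2 hf3 hf4 using hf
  refine ⟨f, fun x => ⟨hf1 x, hf2 x⟩, ?_⟩
  set R := (G.neighborFinset v).filter fun x => ¬ ∃ B ∈ P, x ∈ B with hR
  have hsub : (G.neighborFinset v).image f ⊆ P ∪ R.image fun x => {x} := by
    intro A hA
    obtain ⟨x, hx, rfl⟩ := Finset.mem_image.1 hA
    by_cases h : ∃ B ∈ P, x ∈ B
    · exact Finset.mem_union_left _ (hf3 x h)
    · exact Finset.mem_union_right _ (Finset.mem_image.2
        ⟨x, Finset.mem_filter.2 ⟨hx, h⟩, (hf4 x h).symm⟩)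
  have hRc : R.card ≤ t * t := by
    by_contra! hlt
    obtain ⟨A, hA, hAcl, hAc⟩ := hG.exists_isClique_card (Finset.filter_subset _ _) hlt.le
    obtain ⟨B, hB, hAB⟩ := hmax A ⟨hA.trans (Finset.filter_subset _ _), hAcl, hAc⟩
      (Finset.card_pos.1 (by omega))
    obtain ⟨x, hxA, hxB⟩ := Finset.not_disjoint_iff.1 hAB
    exact (Finset.mem_filter.1 (hA hxA)).2 ⟨B, hB, hxB⟩
  have hPc : P.card * t ≤ 1 * (G.neighborFinset v).card := by
    refine card_mul_le_of_pairwiseDisjoint hd fun A hA => ?_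
    rw [Finset.inter_eq_right.2 (hp A hA).1, (hp A hA).2.2, one_mul]
  rw [one_mul, card_neighborFinset_eq_degree] at hPc
  have h1 : ((G.neighborFinset v).image f).card ≤ P.card + t * t :=
    (Finset.card_le_card hsub).trans ((Finset.card_union_le _ _).trans
      (Nat.add_le_add_left (Finset.card_image_le.trans hRc) _))
  calc ((G.neighborFinset v).image f).card * t ≤ (P.card + t * t) * t :=
        Nat.mul_le_mul_right _ h1
    _ ≤ G.degree v + t ^ 3 := by
        have : (P.card + t * t) * t = P.card * t + t ^ 3 := by ring
        omega

/-! ### Covering by traces. -/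

/-- The edges between disjoint cliques of bounded size and prescribed sets of vertices can be
covered by cliques obtained from the traces of these vertices on the cliques. -/
theorem exists_cliques_covering_edges_to_parts {P : Finset (Finset V)} {k N : ℕ}
    (hP : (P : Set (Finset V)).PairwiseDisjoint id)
    (hclique : ∀ A ∈ P, G.IsClique (A : Set V)) (hk : ∀ A ∈ P, A.card ≤ k)
    (hN : ∀ b, ∃ f : V → Finset V, (∀ x, x ∈ f x ∧ G.IsClique (f x : Set V)) ∧
      ((G.neighborFinset b).image f).card ≤ N)
    (S : Finset V → Finset V) :
    ∃ C : Finset (Finset V), (∀ c ∈ C, G.IsClique (c : Set V)) ∧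
      (∀ A ∈ P, ∀ s ∈ S A, ∀ a ∈ A, G.Adj s a → ∃ c ∈ C, s ∈ c ∧ a ∈ c) ∧
      ∀ v, vertexValency C v ≤ (P.filter fun A => v ∈ S A).card + 2 ^ k * N := by
  -- All vertices complete to a nonempty `B` lie in the neighbourhood of one `b ∈ B`, so the clique
  -- partition at `b` sorts them. The empty trace is never used.
  have hF : ∀ B : Finset V, ∃ F : V → Finset V, ∃ I : Finset (Finset V), I.card ≤ N ∧
      (∀ x, x ∈ F x ∧ G.IsClique (F x : Set V)) ∧
      (B.Nonempty → ∀ x, B ⊆ G.neighborFinset x → F x ∈ I) := by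
    intro B
    rcases B.eq_empty_or_nonempty with rfl | ⟨b, hb⟩
    · exact ⟨fun x => {x}, ∅, by simp, by simp, by simp⟩
    · obtain ⟨f, h1, h2⟩ := hN b
      refine ⟨f, _, h2, h1, fun _ x hx => Finset.mem_image_of_mem _ ?_⟩
      have := hx hb
      rw [mem_neighborFinset] at this ⊢
      exact this.symm
  choose F I hI hFcl hFI using hF
  let Q : Finset V → Finset V → Finset V → Finset V := fun A B i =>
    B ∪ (S A).filter fun s => G.neighborFinset s ∩ A = B ∧ F B s = i
  let J : Finset V → Finset (Finset V) := fun A => A.powerset.filter Finset.Nonempty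
  let C := P.biUnion fun A => (J A).biUnion fun B => (I B).image (Q A B)
  have hC : ∀ c, c ∈ C ↔ ∃ A ∈ P, ∃ B, (B ⊆ A ∧ B.Nonempty) ∧ ∃ i ∈ I B, Q A B i = c := by
    intro c
    simp [C, J]
  refine ⟨C, ?_, ?_, ?_⟩
  · intro c hc
    obtain ⟨A, hA, B, ⟨hBA, hB⟩, i, hi, rfl⟩ := (hC c).1 hc
    have hBcl : G.IsClique (B : Set V) := (hclique A hA).subset (by exact_mod_cast hBA)
    intro x hx y hy hxy
    simp only [Q, Finset.mem_coe, Finset.mem_union, Finset.mem_filter] at hx hy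
    have key : ∀ s, G.neighborFinset s ∩ A = B → ∀ b ∈ B, G.Adj s b := by
      intro s hs b hb
      rw [← hs] at hb
      simpa using (Finset.mem_inter.1 hb).1
    rcases hx with hx | ⟨-, hx1, hx2⟩ <;> rcases hy with hy | ⟨-, hy1, hy2⟩
    · exact hBcl hx hy hxy
    · exact (key y hy1 x hx).symm
    · exact key x hx1 y hy
    · refine (hFcl B x).2 (hFcl B x).1 ?_ hxy
      rw [hx2, ← hy2]
      exact (hFcl B y).1
  · intro A hA s hs a ha hsa
    have haB : a ∈ G.neighborFinset s ∩ A := by simp [ha, hsa]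
    refine ⟨Q A (G.neighborFinset s ∩ A) (F (G.neighborFinset s ∩ A) s), (hC _).2
      ⟨A, hA, _, ⟨Finset.inter_subset_right, ⟨a, haB⟩⟩, _,
        hFI _ ⟨a, haB⟩ s Finset.inter_subset_left, rfl⟩, ?_, ?_⟩
    · exact Finset.mem_union_right _ (by simp [hs])
    · exact Finset.mem_union_left _ haB
  · intro v
    -- `C₁`: outside the trace, `A` alone determines the clique of `v`. `C₂`: `v` lies in at most
    -- one `A`, with at most `2 ^ k` traces and `N` classes each.
    let C₁ := (P.filter fun A => v ∈ S A).image fun A =>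
      Q A (G.neighborFinset v ∩ A) (F (G.neighborFinset v ∩ A) v)
    let C₂ := (P.filter fun A => v ∈ A).biUnion fun A =>
      (J A).biUnion fun B => (I B).image (Q A B)
    have hsub : (C.filter fun c => v ∈ c) ⊆ C₁ ∪ C₂ := by
      intro c hc
      obtain ⟨hcC, hv⟩ := Finset.mem_filter.1 hc
      obtain ⟨A, hA, B, ⟨hBA, hB⟩, i, hi, rfl⟩ := (hC c).1 hcC
      simp only [Q, Finset.mem_union, Finset.mem_filter] at hv
      rcases hv with hv | ⟨hvS, rfl, rfl⟩
      · refine Finset.mem_union_right _ ?_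
        simp only [C₂, J, Finset.mem_biUnion, Finset.mem_filter, Finset.mem_powerset,
          Finset.mem_image]
        exact ⟨A, ⟨hA, hBA hv⟩, B, ⟨hBA, hB⟩, i, hi, rfl⟩
      · exact Finset.mem_union_left _ (Finset.mem_image.2
          ⟨A, Finset.mem_filter.2 ⟨hA, hvS⟩, rfl⟩)
    have hone : (P.filter fun A => v ∈ A).card ≤ 1 := by
      refine Finset.card_le_one.2 fun A hA B hB => ?_
      rw [Finset.mem_filter] at hA hB
      by_contra hAB
      exact Finset.disjoint_left.1 (hP hA.1 hB.1 hAB) hA.2 hB.2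
    have h2 : C₂.card ≤ 1 * (2 ^ k * N) := by
      refine (Finset.card_biUnion_le_card_mul _ _ (2 ^ k * N) fun A hA => ?_).trans
        (Nat.mul_le_mul_right _ hone)
      refine (Finset.card_biUnion_le_card_mul _ _ N fun B _ =>
        Finset.card_image_le.trans (hI B)).trans (Nat.mul_le_mul_right _ ?_)
      refine (Finset.card_filter_le _ _).trans ?_
      rw [Finset.card_powerset]
      exact Nat.pow_le_pow_right (by norm_num) (hk A (Finset.mem_filter.1 hA).1)
    calc vertexValency C v ≤ (C₁ ∪ C₂).card := Finset.card_le_card hsub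
      _ ≤ C₁.card + C₂.card := Finset.card_union_le _ _
      _ ≤ _ := by
        rw [one_mul] at h2
        exact Nat.add_le_add Finset.card_image_le h2

end

/-! ### Sparse digraphs. -/

/-- Repeatedly deleting a vertex of maximum weighted degree does not increase the density. -/
theorem exists_subset_card_eq_sum_mul_le {α : Type*} [DecidableEq α] (w : α → α → ℕ)
    (hsymm : ∀ x y, w x y = w y x) (hdiag : ∀ x, w x x = 0) (T : Finset α) (D : ℕ)
    (hD : ∑ x ∈ T, ∑ y ∈ T, w x y ≤ T.card * D) (d n : ℕ) (hn : n + d = T.card) :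
    ∃ A ⊆ T, A.card = n ∧
      ((∑ x ∈ A, ∑ y ∈ A, w x y : ℕ) : ℤ) * ((T.card : ℤ) - 1) ≤ D * (n * (n - 1)) := by
  induction d generalizing n with
  | zero =>
    obtain rfl : n = T.card := by omega
    refine ⟨T, le_rfl, rfl, ?_⟩
    rcases Nat.eq_zero_or_pos T.card with h | h
    · rw [Finset.card_eq_zero] at h
      simp [h]
    · have h1 : (1 : ℤ) ≤ T.card := by exact_mod_cast h
      have h2 : ((∑ x ∈ T, ∑ y ∈ T, w x y : ℕ) : ℤ) ≤ T.card * D := by exact_mod_cast hD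
      nlinarith [mul_le_mul_of_nonneg_right h2 (sub_nonneg.2 h1)]
  | succ d ih =>
    rcases Nat.eq_zero_or_pos n with rfl | hpos
    · exact ⟨∅, by simp, rfl, by simp⟩
    obtain ⟨A, hA, hAc, hAe⟩ := ih (n + 1) (by omega)
    have hne : A.Nonempty := Finset.card_pos.1 (by omega)
    obtain ⟨v, hv, hmax⟩ := A.exists_max_image (fun x => ∑ y ∈ A, w x y) hne
    have hsum : ∑ x ∈ A, ∑ y ∈ A, w x y ≤ (n + 1) * ∑ y ∈ A, w v y := by
      rw [← hAc, ← smul_eq_mul]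
      exact Finset.sum_le_card_nsmul _ _ _ hmax
    have hsplit : ∑ x ∈ A, ∑ y ∈ A, w x y =
        ∑ x ∈ A.erase v, ∑ y ∈ A.erase v, w x y + 2 * ∑ y ∈ A, w v y := by
      have h1 : ∀ x, ∑ y ∈ A, w x y = ∑ y ∈ A.erase v, w x y + w x v := fun x =>
        (Finset.sum_erase_add _ _ hv).symm
      have h2 : ∑ x ∈ A.erase v, w x v = ∑ y ∈ A, w v y := by
        rw [h1 v, hdiag, add_zero]
        exact Finset.sum_congr rfl fun x _ => hsymm x v
      rw [← Finset.sum_erase_add _ _ hv, Finset.sum_congr rfl fun x _ => h1 x,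
        Finset.sum_add_distrib, h2]
      ring
    refine ⟨A.erase v, (Finset.erase_subset _ _).trans hA, ?_, ?_⟩
    · rw [Finset.card_erase_of_mem hv, hAc, Nat.add_sub_cancel]
    · have hm : (0 : ℤ) ≤ (T.card : ℤ) - 1 := by
        have : (n : ℤ) + (d + 1 : ℕ) = T.card := by exact_mod_cast hn
        push_cast at this
        omega
      have hn1 : (0 : ℤ) ≤ (n : ℤ) - 1 := by omega
      zify at hsum hsplit
      push_cast at hAe ⊢
      set e := (∑ x ∈ A, ∑ y ∈ A, (w x y : ℤ))
      set e' := (∑ x ∈ A.erase v, ∑ y ∈ A.erase v, (w x y : ℤ))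
      set g := (∑ y ∈ A, (w v y : ℤ))
      -- The deleted degree `g` is at least the average `e / (n + 1)`, and `e' = e - 2 * g`.
      have h3 : e' * (n + 1) ≤ e * (n - 1) := by
        nlinarith
      have h4 : (e' * (T.card - 1)) * (n + 1) ≤ (D * (n * (n - 1))) * (n + 1) := by
        calc (e' * ((T.card : ℤ) - 1)) * (n + 1) = (e' * (n + 1)) * (T.card - 1) := by ring
          _ ≤ (e * (n - 1)) * (T.card - 1) := mul_le_mul_of_nonneg_right h3 hm
          _ = (e * (T.card - 1)) * (n - 1) := by ring
          _ ≤ (D * ((n + 1) * (n + 1 - 1))) * (n - 1) := mul_le_mul_of_nonneg_right hAe hn1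
          _ = _ := by ring
      exact le_of_mul_le_mul_right h4 (by positivity)

/-- A large digraph of small maximum outdegree has an induced subgraph on `k` vertices in which all
indegrees are at most `k / 2`. -/
theorem exists_subset_card_eq_indegree_le {α : Type*} [DecidableEq α] (r : α → α → Prop)
    [DecidableRel r] (T : Finset α) (s k : ℕ)
    (hs : ∀ z ∈ T, (T.filter fun u => r z u).card ≤ s) (hT : 16 * s + 2 * k + 1 ≤ T.card) :
    ∃ A ⊆ T, A.card = k ∧
      ∀ u ∈ A, 2 * (A.filter fun z => z ≠ u ∧ r z u).card ≤ k := by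
  let w : α → α → ℕ := fun x y =>
    if x = y then 0 else (if r x y then 1 else 0) + (if r y x then 1 else 0)
  have hsymm : ∀ x y, w x y = w y x := fun x y => by
    simp only [w, eq_comm (a := x) (b := y)]
    split_ifs <;> rfl
  have hw : ∑ x ∈ T, ∑ y ∈ T, w x y ≤ T.card * (2 * s) := by
    have h1 : ∑ x ∈ T, ∑ y ∈ T, (if r x y then 1 else 0) ≤ T.card * s := by
      rw [← smul_eq_mul]
      refine Finset.sum_le_card_nsmul _ _ _ fun x hx => ?_
      rw [← Finset.card_filter]
      exact hs x hx
    have h2 : ∑ x ∈ T, ∑ y ∈ T, w x y ≤ ∑ x ∈ T, ∑ y ∈ T,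
        ((if r x y then 1 else 0) + (if r y x then 1 else 0)) := by
      refine Finset.sum_le_sum fun x _ => Finset.sum_le_sum fun y _ => ?_
      simp only [w]
      split_ifs <;> simp
    have h3 : ∑ x ∈ T, ∑ y ∈ T, (if r y x then 1 else 0) =
        ∑ x ∈ T, ∑ y ∈ T, (if r x y then 1 else 0) := Finset.sum_comm
    simp only [Finset.sum_add_distrib] at h2
    rw [h3] at h2
    linarith
  obtain ⟨A, hA, hAc, hAe⟩ := exists_subset_card_eq_sum_mul_le w hsymm (fun x => by simp [w]) T
    (2 * s) hw (T.card - 2 * k) (2 * k) (by omega)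
  -- The density bound gives total weight at most `k ^ 2 / 2` on the `2 * k` vertices of `A`, so at
  -- most `k` are bad and `k` good ones remain.
  let bad := A.filter fun u => k < 2 * ∑ y ∈ A, w u y
  have hbad : bad.card ≤ k := by
    by_contra! hlt
    have h1 : bad.card * (k + 1) ≤ 2 * ∑ x ∈ A, ∑ y ∈ A, w x y := by
      rw [Finset.mul_sum]
      calc bad.card * (k + 1) ≤ ∑ x ∈ bad, 2 * ∑ y ∈ A, w x y := by
            rw [← smul_eq_mul]
            exact Finset.card_nsmul_le_sum _ _ _ fun x hx => (Finset.mem_filter.1 hx).2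
        _ ≤ _ := Finset.sum_le_sum_of_subset (Finset.filter_subset _ _)
    have h2 : (k + 1) * (k + 1) ≤ 2 * ∑ x ∈ A, ∑ y ∈ A, w x y :=
      (Nat.mul_le_mul_right _ hlt).trans h1
    have hTm : (16 * s + 2 * k : ℤ) ≤ (T.card : ℤ) - 1 := by
      have : ((16 * s + 2 * k + 1 : ℕ) : ℤ) ≤ T.card := by exact_mod_cast hT
      push_cast at this
      linarith
    set e := ∑ x ∈ A, ∑ y ∈ A, w x y
    have h2' : ((k : ℤ) + 1) * (k + 1) ≤ 2 * e := by exact_mod_cast h2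
    push_cast at hAe
    have h3 : (e : ℤ) * (16 * s + 2 * k) ≤ 2 * s * (2 * k * (2 * k - 1)) :=
      (mul_le_mul_of_nonneg_left hTm (by positivity)).trans hAe
    have hs0 : (0 : ℤ) ≤ s := by positivity
    have hk0 : (0 : ℤ) ≤ k := by positivity
    have h4 := mul_le_mul_of_nonneg_right h2' (show (0 : ℤ) ≤ 8 * s + k by positivity)
    have h5 : (0 : ℤ) ≤ s * k := by positivity
    have h6 : ((k : ℤ) + 1) * (k + 1) * (8 * s + k) ≤ 2 * s * (2 * k * (2 * k - 1)) := by linarith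
    have h7 : (0 : ℤ) ≤ k * k * k := by positivity
    have h8 : (0 : ℤ) ≤ k * k := by positivity
    rcases Nat.eq_zero_or_pos k with rfl | hk
    · obtain rfl : A = ∅ := by simpa using hAc
      simp [bad] at hlt
    · have : (1 : ℤ) ≤ k := by exact_mod_cast hk
      nlinarith
  obtain ⟨B, hB, hBc⟩ := Finset.exists_subset_card_eq (s := A \ bad) (n := k) (by
    have := Finset.le_card_sdiff bad A
    omega)
  refine ⟨B, hB.trans (Finset.sdiff_subset.trans hA), hBc, fun u hu => ?_⟩
  have hu' := Finset.mem_sdiff.1 (hB hu)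
  have hle : 2 * ∑ y ∈ A, w u y ≤ k := by
    by_contra! h
    exact hu'.2 (Finset.mem_filter.2 ⟨hu'.1, h⟩)
  refine le_trans (Nat.mul_le_mul_left 2 ?_) hle
  rw [Finset.card_filter]
  refine (Finset.sum_le_sum fun z _ => ?_).trans
    (Finset.sum_le_sum_of_subset (hB.trans Finset.sdiff_subset))
  simp only [w]
  split_ifs with h1 h2 h3 <;> simp_all

/-! ### Strong attachment. -/

section

variable {V : Type*} [Fintype V] [DecidableEq V] {G : SimpleGraph V} [DecidableRel G.Adj]

/-- A vertex is strongly attached to a `k`-set `A` if it is adjacent to at least half of `A`. -/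
def IsStrong (G : SimpleGraph V) [DecidableRel G.Adj] (k : ℕ) (v : V) (A : Finset V) : Prop :=
  k ≤ 2 * (G.neighborFinset v ∩ A).card

instance (k : ℕ) (v : V) (A : Finset V) : Decidable (G.IsStrong k v A) :=
  inferInstanceAs (Decidable (k ≤ _))

theorem isStrong_of_mem {k : ℕ} (hk : 2 ≤ k) {A : Finset V} (hA : G.IsClique (A : Set V))
    (hAc : A.card = k) {v : V} (hv : v ∈ A) : G.IsStrong k v A := by
  have hsub : A.erase v ⊆ G.neighborFinset v ∩ A := by
    intro x hx
    rw [Finset.mem_erase] at hx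
    simp only [Finset.mem_inter, mem_neighborFinset]
    exact ⟨hA hv hx.2 hx.1.symm, hx.2⟩
  have := Finset.card_le_card hsub
  rw [Finset.card_erase_of_mem hv] at this
  unfold IsStrong
  omega

theorem card_isStrong_le {P : Finset (Finset V)} (hP : (P : Set (Finset V)).PairwiseDisjoint id)
    {k d : ℕ} (hk : 0 < k) {v : V} (hd : G.degree v ≤ d) :
    (P.filter fun A => G.IsStrong k v A).card ≤ 2 * d / k := by
  rw [Nat.le_div_iff_mul_le hk]
  refine (card_mul_le_of_pairwiseDisjoint (T := G.neighborFinset v) (m := 2) ?_ ?_).trans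
    (Nat.mul_le_mul_left 2 hd)
  · exact hP.subset (by exact_mod_cast Finset.filter_subset _ _)
  · exact fun A hA => (Finset.mem_filter.1 hA).2

/-- The neighbours of a vertex `v` of a `k`-clique that are not strongly attached to this clique
are pairwise adjacent. -/
theorem IsClawFree.adj_of_not_isStrong (hG : G.IsClawFree) {k : ℕ} (hk : 2 ≤ k) {A : Finset V}
    (hA : G.IsClique (A : Set V)) (hAc : A.card = k) {v u u' : V} (hv : v ∈ A)
    (hu : G.Adj v u) (hu' : G.Adj v u') (huu' : u ≠ u')
    (hs : ¬ G.IsStrong k u A) (hs' : ¬ G.IsStrong k u' A) : G.Adj u u' := by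
  have huA : u ∉ A := fun h => hs (isStrong_of_mem hk hA hAc h)
  have huA' : u' ∉ A := fun h => hs' (isStrong_of_mem hk hA hAc h)
  unfold IsStrong at hs hs'
  -- Some `a ∈ A` is missed by both, and `v` would be the centre of a claw on `a`, `u`, `u'`.
  have hlt : ((G.neighborFinset u ∩ A) ∪ (G.neighborFinset u' ∩ A)).card < A.card := by
    have := Finset.card_union_le (G.neighborFinset u ∩ A) (G.neighborFinset u' ∩ A)
    omega
  obtain ⟨a, ha, hna⟩ := Finset.exists_mem_notMem_of_card_lt_card hlt
  simp only [Finset.mem_union, Finset.mem_inter, mem_neighborFinset, ha, and_true, not_or] at hna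
  have hav : v ≠ a := fun h => hna.1 (h ▸ hu.symm)
  exact hG.adj_of_not_adj (hA hv ha hav) hu hu' (fun h => huA (h ▸ ha)) (fun h => huA' (h ▸ ha))
    (fun h => hna.1 h.symm) (fun h => hna.2 h.symm) huu'

/-- If a neighbour `v` of `u` is not strongly attached to either of two `k`-cliques containing `u`,
then most vertices of the first one are strongly attached to the second one. -/
theorem IsClawFree.lt_card_isStrong (hG : G.IsClawFree) {k : ℕ} (hk : 2 ≤ k) {A B : Finset V}
    (hA : G.IsClique (A : Set V)) (hAc : A.card = k) (hB : G.IsClique (B : Set V))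
    (hBc : B.card = k) {u v : V} (huA : u ∈ A) (huB : u ∈ B) (huv : G.Adj u v)
    (hvA : ¬ G.IsStrong k v A) (hvB : ¬ G.IsStrong k v B) :
    k < 2 * (A.filter fun z => z ≠ u ∧ G.IsStrong k z B).card := by
  have hvA' : v ∉ A := fun h => hvA (isStrong_of_mem hk hA hAc h)
  have hvB' : v ∉ B := fun h => hvB (isStrong_of_mem hk hB hBc h)
  -- If `z ∈ A` and `w ∈ B` are distinct and both miss `v`, no claw at `u` means `z` and `w` are
  -- adjacent. More than half of each clique misses `v`.
  have hsub : A \ G.neighborFinset v ⊆ A.filter fun z => z ≠ u ∧ G.IsStrong k z B := by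
    intro z hz
    simp only [Finset.mem_sdiff, mem_neighborFinset] at hz
    have hzu : z ≠ u := fun h => hz.2 (h ▸ huv.symm)
    refine Finset.mem_filter.2 ⟨hz.1, hzu, ?_⟩
    by_cases hzB : z ∈ B
    · exact isStrong_of_mem hk hB hBc hzB
    have hsub' : B \ G.neighborFinset v ⊆ G.neighborFinset z ∩ B := by
      intro w hw
      simp only [Finset.mem_sdiff, mem_neighborFinset] at hw
      have hwu : w ≠ u := fun h => hw.2 (h ▸ huv.symm)
      simp only [Finset.mem_inter, mem_neighborFinset]
      refine ⟨?_, hw.1⟩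
      exact hG.adj_of_not_adj huv (hA huA hz.1 hzu.symm) (hB huB hw.1 hwu.symm)
        (fun h => hvA' (h ▸ hz.1)) (fun h => hvB' (h ▸ hw.1)) hz.2 hw.2 (fun h => hzB (h ▸ hw.1))
    have h1 := Finset.card_le_card hsub'
    have h2 := Finset.card_sdiff_add_card_inter B (G.neighborFinset v)
    rw [Finset.inter_comm] at h2
    unfold IsStrong at hvB ⊢
    omega
  have h1 := Finset.card_le_card hsub
  have h2 := Finset.card_sdiff_add_card_inter A (G.neighborFinset v)
  rw [Finset.inter_comm] at h2
  unfold IsStrong at hvA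
  omega

/-! ### Assembling the covering. -/

/-- The trace covering applied to singleton parts, each with its full neighbourhood as prescribed
set. -/
theorem exists_cliques_covering_star {k N : ℕ} (hk : 1 ≤ k) (R : Finset V)
    (hN : ∀ b, ∃ f : V → Finset V, (∀ x, x ∈ f x ∧ G.IsClique (f x : Set V)) ∧
      ((G.neighborFinset b).image f).card ≤ N) :
    ∃ C : Finset (Finset V), (∀ c ∈ C, G.IsClique (c : Set V)) ∧
      (∀ a ∈ R, ∀ s, G.Adj s a → ∃ c ∈ C, s ∈ c ∧ a ∈ c) ∧
      ∀ v, vertexValency C v ≤ (G.neighborFinset v ∩ R).card + 2 ^ k * N := by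
  obtain ⟨C, h1, h2, h3⟩ := exists_cliques_covering_edges_to_parts (G := G)
    (P := R.image fun a => {a}) (k := k) (N := N)
    (by
      intro A hA B hB hAB
      simp only [Finset.coe_image, Set.mem_image] at hA hB
      obtain ⟨a, -, rfl⟩ := hA
      obtain ⟨b, -, rfl⟩ := hB
      exact Finset.disjoint_singleton.2 fun h => hAB (by rw [h]))
    (by
      intro A hA
      obtain ⟨a, -, rfl⟩ := Finset.mem_image.1 hA
      simp)
    (by
      intro A hA
      obtain ⟨a, -, rfl⟩ := Finset.mem_image.1 hA
      simpa using hk)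
    hN (fun A => Finset.univ.filter fun s => ∃ a ∈ A, G.Adj s a)
  refine ⟨C, h1, fun a ha s hs => ?_, fun v => (h3 v).trans (Nat.add_le_add_right ?_ _)⟩
  · exact h2 {a} (Finset.mem_image_of_mem _ ha) s (by simpa using hs) a (by simp) hs
  · refine (Finset.card_le_card (t := (G.neighborFinset v ∩ R).image fun a => {a}) ?_).trans
      Finset.card_image_le
    intro A hA
    obtain ⟨hA, hv⟩ := Finset.mem_filter.1 hA
    obtain ⟨a, ha, rfl⟩ := Finset.mem_image.1 hA
    have hva : G.Adj v a := by simpa using hv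
    exact Finset.mem_image.2 ⟨a, by simp [ha, hva], rfl⟩

theorem IsClawFree.exists_isCliqueCovering_valency_le (hG : G.IsClawFree) {k N d : ℕ}
    (hk : 2 ≤ k) (hd : ∀ v, G.degree v ≤ d)
    (hN : ∀ b, ∃ f : V → Finset V, (∀ x, x ∈ f x ∧ G.IsClique (f x : Set V)) ∧
      ((G.neighborFinset b).image f).card ≤ N) :
    ∃ C : Finset (Finset V), G.IsCliqueCovering C ∧
      ∀ v, vertexValency C v ≤ k * k + 2 * k + 18 * (2 * d / k) + 4 * (2 ^ k * N) := by
  classical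
  obtain ⟨P, hp, hPd, hPmax⟩ := exists_maximal_disjoint_family fun A : Finset V =>
    G.IsClique (A : Set V) ∧ A.card = k
  have hpart : ∀ x, ∃ A : Finset V, (∃ B ∈ P, x ∈ B) → A ∈ P ∧ x ∈ A := by
    intro x
    by_cases h : ∃ B ∈ P, x ∈ B
    · obtain ⟨B, hB⟩ := h
      exact ⟨B, fun _ => hB⟩
    · exact ⟨∅, fun h' => absurd h' h⟩
  choose part hpart using hpart
  have hpart_eq : ∀ A ∈ P, ∀ x ∈ A, part x = A := by
    intro A hA x hx
    obtain ⟨h1, h2⟩ := hpart x ⟨A, hA, hx⟩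
    by_contra hne
    exact Finset.disjoint_left.1 (hPd h1 hA hne) h2 hx
  let R : Finset V := Finset.univ.filter fun x => ¬ ∃ B ∈ P, x ∈ B
  have hR : ∀ v, (G.neighborFinset v ∩ R).card ≤ k * k := by
    intro v
    by_contra! hlt
    obtain ⟨A, hA, hAcl, hAc⟩ := hG.exists_isClique_card Finset.inter_subset_left hlt.le
    obtain ⟨B, hB, hAB⟩ := hPmax A ⟨hAcl, hAc⟩ (Finset.card_pos.1 (by omega))
    obtain ⟨x, hxA, hxB⟩ := Finset.not_disjoint_iff.1 hAB
    exact (Finset.mem_filter.1 (Finset.mem_inter.1 (hA hxA)).2).2 ⟨B, hB, hxB⟩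
  obtain ⟨Q, hq, hQd, hQmax⟩ := exists_maximal_disjoint_family fun A : Finset V =>
    G.IsClique (A : Set V) ∧ A.card = k ∧
      ∀ u ∈ A, 2 * (A.filter fun z => z ≠ u ∧ G.IsStrong k z (part u)).card ≤ k
  let W : V → V → Prop := fun x u => G.Adj x u ∧ (∃ B ∈ P, x ∈ B) ∧ (∃ B ∈ P, u ∈ B) ∧
    ¬ G.IsStrong k x (part u) ∧ ¬ G.IsStrong k u (part x)
  let S : Finset V → Finset V := fun A =>
    Finset.univ.filter fun x => ∃ u ∈ A, (¬ ∃ B ∈ Q, u ∈ B) ∧ W x u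
  let S' : Finset V → Finset V := fun A => Finset.univ.filter fun x => G.IsStrong k x A
  -- Otherwise choose one weak neighbour missed by `Q` per part. Since the parts are distinct,
  -- outdegrees for strong attachment are at most `2 * d / k`, and a `k`-subset contradicts the
  -- maximality of `Q`.
  have hhit : ∀ x, (P.filter fun A => x ∈ S A).card ≤ 16 * (2 * d / k) + 2 * k := by
    intro x
    by_contra! hlt
    set H := P.filter fun A => x ∈ S A with hH
    have hg : ∀ A : Finset V, ∃ u, A ∈ H → A ∈ P ∧ u ∈ A ∧ (¬ ∃ B ∈ Q, u ∈ B) ∧ W x u := by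
      intro A
      by_cases hA : A ∈ H
      · obtain ⟨hAP, hxS⟩ := Finset.mem_filter.1 hA
        obtain ⟨-, u, hu, huQ, hW⟩ := Finset.mem_filter.1 hxS
        exact ⟨u, fun _ => ⟨hAP, hu, huQ, hW⟩⟩
      · exact ⟨x, fun h => absurd h hA⟩
    choose g hg using hg
    have hgpart : ∀ A ∈ H, part (g A) = A := fun A hA =>
      hpart_eq A (hg A hA).1 _ (hg A hA).2.1
    have hTcard : (H.image g).card = H.card := by
      refine Finset.card_image_of_injOn fun A hA B hB hAB => ?_
      rw [← hgpart A hA, ← hgpart B hB, hAB]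
    have hT : ∀ u ∈ H.image g, (¬ ∃ B ∈ Q, u ∈ B) ∧ W x u := by
      intro u hu
      obtain ⟨A, hA, rfl⟩ := Finset.mem_image.1 hu
      exact (hg A hA).2.2
    obtain ⟨A, hA, hAc, hAin⟩ := exists_subset_card_eq_indegree_le
      (fun z u => G.IsStrong k z (part u)) (H.image g) (2 * d / k) k (by
        intro z _
        refine le_trans ?_ (card_isStrong_le (v := z) hPd (by omega) (hd z))
        refine Finset.card_le_card_of_injOn part ?_ ?_
        · intro u hu
          obtain ⟨hu, hz⟩ := Finset.mem_filter.1 hu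
          exact Finset.mem_filter.2 ⟨(hpart u (hT u hu).2.2.2.1).1, hz⟩
        · intro u hu u' hu' h
          obtain ⟨B, hB, rfl⟩ := Finset.mem_image.1 (Finset.mem_filter.1 hu).1
          obtain ⟨B', hB', rfl⟩ := Finset.mem_image.1 (Finset.mem_filter.1 hu').1
          rw [hgpart B hB, hgpart B' hB'] at h
          rw [h]) (by omega)
    have hAcl : G.IsClique (A : Set V) := by
      intro u hu u' hu' hne
      have h1 := (hT u (hA hu)).2
      have h2 := (hT u' (hA hu')).2
      obtain ⟨hxP, hx⟩ := hpart x h1.2.1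
      exact hG.adj_of_not_isStrong hk (hp _ hxP).1 (hp _ hxP).2 hx h1.1 h2.1 hne h1.2.2.2.2
        h2.2.2.2.2
    obtain ⟨B, hB, hAB⟩ := hQmax A ⟨hAcl, hAc, hAin⟩ (Finset.card_pos.1 (by omega))
    obtain ⟨u, huA, huB⟩ := Finset.not_disjoint_iff.1 hAB
    exact (hT u (hA huA)).1 ⟨B, hB, huB⟩
  obtain ⟨C₀, hcl₀, hcov₀, hval₀⟩ := exists_cliques_covering_star (k := k) (by omega) R hN
  obtain ⟨C₁, hcl₁, hcov₁, hval₁⟩ := exists_cliques_covering_edges_to_parts hPd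
    (fun A hA => (hp A hA).1) (fun A hA => (hp A hA).2.le) hN S'
  obtain ⟨C₂, hcl₂, hcov₂, hval₂⟩ := exists_cliques_covering_edges_to_parts hQd
    (fun A hA => (hq A hA).1) (fun A hA => (hq A hA).2.1.le) hN S'
  obtain ⟨C₃, hcl₃, hcov₃, hval₃⟩ := exists_cliques_covering_edges_to_parts hPd
    (fun A hA => (hp A hA).1) (fun A hA => (hp A hA).2.le) hN S
  refine ⟨C₀ ∪ C₁ ∪ (C₂ ∪ C₃), ⟨?_, ?_⟩, ?_⟩
  · intro c hc
    simp only [Finset.mem_union] at hc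
    rcases hc with (hc | hc) | (hc | hc)
    exacts [hcl₀ c hc, hcl₁ c hc, hcl₂ c hc, hcl₃ c hc]
  · intro x y hxy
    have hlift : ∀ C ⊆ C₀ ∪ C₁ ∪ (C₂ ∪ C₃), (∃ c ∈ C, x ∈ c ∧ y ∈ c) →
        ∃ c ∈ C₀ ∪ C₁ ∪ (C₂ ∪ C₃), x ∈ c ∧ y ∈ c := fun C hC ⟨c, hc, h⟩ => ⟨c, hC hc, h⟩
    have s₀ : C₀ ⊆ C₀ ∪ C₁ ∪ (C₂ ∪ C₃) := fun c hc => by simp [hc]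
    have s₁ : C₁ ⊆ C₀ ∪ C₁ ∪ (C₂ ∪ C₃) := fun c hc => by simp [hc]
    have s₂ : C₂ ⊆ C₀ ∪ C₁ ∪ (C₂ ∪ C₃) := fun c hc => by simp [hc]
    have s₃ : C₃ ⊆ C₀ ∪ C₁ ∪ (C₂ ∪ C₃) := fun c hc => by simp [hc]
    by_cases hxP : ∃ B ∈ P, x ∈ B
    swap
    · obtain ⟨c, hc, h1, h2⟩ := hcov₀ x (by simpa [R] using hxP) y hxy.symm
      exact hlift C₀ s₀ ⟨c, hc, h2, h1⟩
    by_cases hyP : ∃ B ∈ P, y ∈ B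
    swap
    · exact hlift C₀ s₀ (hcov₀ y (by simpa [R] using hyP) x hxy)
    obtain ⟨hx1, hx2⟩ := hpart x hxP
    obtain ⟨hy1, hy2⟩ := hpart y hyP
    by_cases hxs : G.IsStrong k x (part y)
    · exact hlift C₁ s₁ (hcov₁ (part y) hy1 x (by simpa [S'] using hxs) y hy2 hxy)
    by_cases hys : G.IsStrong k y (part x)
    · obtain ⟨c, hc, h1, h2⟩ := hcov₁ (part x) hx1 y (by simpa [S'] using hys) x hx2 hxy.symm
      exact hlift C₁ s₁ ⟨c, hc, h2, h1⟩
    by_cases hyQ : ∃ B ∈ Q, y ∈ B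
    · obtain ⟨B, hB, hyB⟩ := hyQ
      refine hlift C₂ s₂ (hcov₂ B hB x ?_ y hyB hxy)
      by_contra hxB
      have hxB' : ¬ G.IsStrong k x B := by simpa [S'] using hxB
      have := hG.lt_card_isStrong hk (hq B hB).1 (hq B hB).2.1 (hp _ hy1).1 (hp _ hy1).2 hyB hy2
        hxy.symm hxB' hxs
      exact absurd ((hq B hB).2.2 y hyB) (not_le.2 this)
    · refine hlift C₃ s₃ (hcov₃ (part y) hy1 x ?_ y hy2 hxy)
      exact Finset.mem_filter.2 ⟨Finset.mem_univ _, y, hy2, hyQ, hxy, hxP, hyP, hxs, hys⟩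
  · intro v
    have hS' : ∀ A, v ∈ S' A ↔ G.IsStrong k v A := fun A => by simp [S']
    have h0 := hval₀ v
    have h1 := hval₁ v
    have h2 := hval₂ v
    have h3 := hval₃ v
    simp only [hS'] at h1 h2
    have hs1 := card_isStrong_le (v := v) hPd (show 0 < k by omega) (hd v)
    have hs2 := card_isStrong_le (v := v) hQd (show 0 < k by omega) (hd v)
    have hr := hR v
    have hh := hhit v
    have u1 := vertexValency_union_le (C₀ ∪ C₁) (C₂ ∪ C₃) v
    have u2 := vertexValency_union_le C₀ C₁ v
    have u3 := vertexValency_union_le C₂ C₃ v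
    omega

/-! ### Choice of parameters. -/

/-- Covering the edges one at a time. -/
theorem lcc_le_three_mul_maxDegree (G : SimpleGraph V) [DecidableRel G.Adj] :
    G.lcc ≤ 3 * G.maxDegree := by
  obtain ⟨C, h1, h2, h3⟩ := exists_cliques_covering_star (G := G) (k := 1) (N := G.maxDegree)
    le_rfl Finset.univ fun b => ⟨fun x => {x}, by simp, Finset.card_image_le.trans (by
      rw [card_neighborFinset_eq_degree]; exact G.degree_le_maxDegree b)⟩
  refine lcc_le ⟨h1, fun x y h => h2 y (Finset.mem_univ _) x h⟩ fun v => (h3 v).trans ?_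
  have := G.degree_le_maxDegree v
  rw [Finset.inter_univ, card_neighborFinset_eq_degree]
  omega

/-- Neighbourhoods are partitioned with `t = 4 ^ k`: then `N` is at most `2 * d / 4 ^ k`, which
absorbs the `2 ^ k` traces and still leaves a factor `2 ^ k ≥ k`. The constant is 1 + 2 + 36 + 8. -/
theorem IsClawFree.lcc_mul_le (hG : G.IsClawFree) {k : ℕ} (hk : 2 ≤ k)
    (hd : 2 ^ (8 * k) ≤ G.maxDegree) : G.lcc * k ≤ 47 * G.maxDegree := by
  set d := G.maxDegree with hdd
  have ht : 0 < 4 ^ k := by positivity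
  obtain ⟨C, hC, hval⟩ := hG.exists_isCliqueCovering_valency_le
    (N := (d + (4 ^ k) ^ 3) / 4 ^ k) hk (fun v => G.degree_le_maxDegree v) (fun b => by
      obtain ⟨f, h1, h2⟩ := hG.exists_clique_partition b ht
      refine ⟨f, h1, (Nat.le_div_iff_mul_le ht).2 (h2.trans ?_)⟩
      exact Nat.add_le_add_right (G.degree_le_maxDegree b) _)
  set N := (d + (4 ^ k) ^ 3) / 4 ^ k
  have hNt : N * 4 ^ k ≤ d + (4 ^ k) ^ 3 := Nat.div_mul_le_self _ _
  have hs : 2 * d / k * k ≤ 2 * d := Nat.div_mul_le_self _ _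
  have hkp : k ≤ 2 ^ k := Nat.lt_two_pow_self.le
  have hp : (4 : ℕ) ^ k = 2 ^ k * 2 ^ k := by rw [← mul_pow]; norm_num
  have hlcc := lcc_le hC hval
  rw [← hdd] at hlcc
  have h8 : (2 : ℕ) ^ (8 * k) = (2 ^ k) ^ 8 := by rw [← pow_mul, mul_comm]
  rw [h8] at hd
  rw [hp] at hNt
  set q := 2 ^ k
  have hq1 : 1 ≤ q := by omega
  have h6 : (q * q) ^ 3 ≤ d := by
    calc (q * q) ^ 3 = q ^ 6 := by ring
      _ ≤ q ^ 8 := Nat.pow_le_pow_right hq1 (by norm_num)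
      _ ≤ d := hd
  have hk3 : k * k * k ≤ d := by
    calc k * k * k ≤ q * q * q := by gcongr
      _ = q ^ 3 := by ring
      _ ≤ q ^ 8 := Nat.pow_le_pow_right hq1 (by norm_num)
      _ ≤ d := hd
  have hk2 : k * k ≤ d :=
    (Nat.le_mul_of_pos_right _ (by omega)).trans hk3
  have hqN : q * N * k ≤ 2 * d := by
    calc q * N * k ≤ q * N * q := by gcongr
      _ = N * (q * q) := by ring
      _ ≤ 2 * d := by omega
  calc G.lcc * k ≤ (k * k + 2 * k + 18 * (2 * d / k) + 4 * (q * N)) * k :=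
        Nat.mul_le_mul_right _ hlcc
    _ = k * k * k + 2 * (k * k) + 18 * (2 * d / k * k) + 4 * (q * N * k) := by ring
    _ ≤ 47 * d := by omega

end

end SimpleGraph

theorem theorem4p1 :
    ∃ c : ℝ, 0 < c ∧
      ∀ (V : Type*) [Fintype V] [DecidableEq V] (G : SimpleGraph V) [DecidableRel G.Adj],
        G.IsClawFree → 2 ≤ G.maxDegree →
          (G.lcc : ℝ) ≤ c * ((G.maxDegree : ℝ) / Real.log (G.maxDegree : ℝ)) := by
  -- Any constant from 47 * 12 = 564 on works; the small case needs only 3 * 16.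
  refine ⟨1000, by norm_num, fun V _ _ G _ hG hd => ?_⟩
  set d := G.maxDegree with hdd
  have hd0 : (0 : ℝ) ≤ d := by positivity
  have hlogpos : 0 < Real.log d := Real.log_pos (by exact_mod_cast hd)
  have hlog : Real.log d ≤ Nat.log 2 d + 1 := by
    have h1 : (d : ℝ) ≤ 2 ^ (Nat.log 2 d + 1) := by
      exact_mod_cast (Nat.lt_pow_succ_log_self (by norm_num) d).le
    calc Real.log d ≤ Real.log (2 ^ (Nat.log 2 d + 1)) := Real.log_le_log (by positivity) h1
      _ = (Nat.log 2 d + 1 : ℕ) * Real.log 2 := Real.log_pow _ _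
      _ ≤ (Nat.log 2 d + 1 : ℕ) * 1 := by
        gcongr
        linarith [Real.log_two_lt_d9]
      _ = Nat.log 2 d + 1 := by push_cast; ring
  rw [mul_div_assoc', le_div_iff₀ hlogpos]
  -- The parameter is `k = Nat.log 2 d / 8`, so that `2 ^ (8 * k) ≤ d`; for `k < 2` the logarithm is
  -- bounded and the trivial covering suffices.
  rcases Nat.lt_or_ge (Nat.log 2 d / 8) 2 with hk | hk
  · have h1 : (G.lcc : ℝ) ≤ 3 * d := by exact_mod_cast G.lcc_le_three_mul_maxDegree
    have h2 : (Nat.log 2 d : ℝ) ≤ 15 := by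
      exact_mod_cast (show Nat.log 2 d ≤ 15 by omega)
    calc (G.lcc : ℝ) * Real.log d ≤ 3 * d * 16 := by gcongr; linarith
      _ ≤ 1000 * d := by linarith
  · have h1 : G.lcc * (Nat.log 2 d / 8) ≤ 47 * d := by
      refine hG.lcc_mul_le hk ((Nat.pow_le_pow_right (by norm_num) ?_).trans
        (Nat.pow_log_le_self 2 (by omega)))
      exact Nat.mul_div_le _ _
    have h2 : Nat.log 2 d + 1 ≤ 12 * (Nat.log 2 d / 8) := by omega
    have h1' : (G.lcc : ℝ) * (Nat.log 2 d / 8 : ℕ) ≤ 47 * d := by exact_mod_cast h1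
    have h2' : (Nat.log 2 d : ℝ) + 1 ≤ 12 * (Nat.log 2 d / 8 : ℕ) := by exact_mod_cast h2
    calc (G.lcc : ℝ) * Real.log d ≤ G.lcc * (12 * (Nat.log 2 d / 8 : ℕ)) := by
          gcongr; linarith
      _ ≤ 1000 * d := by linarith
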